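/- Let $\mathcal{E}$ be an exact category in the sense of Quillen, i.e. an additive category with a class of kernel-cokernel pairs (called conflations; their first maps are inflations, their second maps deflations) closed under isomorphisms, such that: every $X\to 0$ is a deflation, deflations are closed under composition, and pullbacks along deflations exist and preserve deflations; and dually, every $0\to X$ is an inflation, inflations are closed under composition, and pushouts along inflations exist and preserve inflations. A morphism is called admissible if it is the composite of a deflation followed by an inflation. Let $\mathcal{A}\subseteq\mathcal{E}$ be a two-sided admissibly percolating subcategory, i.e. a full nonempty subcategory such that (1) for every conflation $X\to Y\to Z$ in $\mathcal{E}$ one has $Y\in\mathcal{A}$ if and only if $X,Z\in\mathcal{A}$, and (2) every morphism $X\to T$ and every morphism $T\to X$ with $T\in\mathcal{A}$ is admissible with image in $\mathcal{A}$. Let $\Sigma_{\mathcal{A}}$ be the class of admissible morphisms in $\mathcal{E}$ whose kernel and cokernel lie in $\mathcal{A}$, and let $Q\colon\mathcal{E}\to\mathcal{E}/\mathcal{A}:=\Sigma_{\mathcal{A}}^{-1}\mathcal{E}$ be the localization functor. The conflations of $\mathcal{E}/\mathcal{A}$ are the sequences isomorphic in $\mathcal{E}/\mathcal{A}$ to the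 image under $Q$ of a conflation of $\mathcal{E}$, and inflations, deflations and admissible morphisms in $\mathcal{E}/\mathcal{A}$ are defined with respect to these. **Theorem.** A morphism $f\colon X\to Y$ in $\mathcal{E}$ is admissible in $\mathcal{E}$ if and only if $Q(f)$ is admissible in $\mathcal{E}/\mathcal{A}$. -/

import Mathlib

open CategoryTheory CategoryTheory.Limits

universe v v' u u'

namespace PercolatingQuotient

/-- A class of composable pairs `X ⟶ Y ⟶ Z` in a category, thought of as the class of chosen
conflations. -/
structure SequenceClass (C : Type u) [Category.{v} C] where
  /-- `Conflation f g` means that the sequence `f, g` belongs to the class. -/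
  Conflation : ∀ {X Y Z : C}, (X ⟶ Y) → (Y ⟶ Z) → Prop

namespace SequenceClass

variable {C : Type u} [Category.{v} C] (K : SequenceClass C)

/-- An inflation is the first map of a conflation. -/
def Inflation {X Y : C} (i : X ⟶ Y) : Prop :=
  ∃ (Z : C) (p : Y ⟶ Z), K.Conflation i p

/-- A deflation is the second map of a conflation. -/
def Deflation {Y Z : C} (p : Y ⟶ Z) : Prop :=
  ∃ (X : C) (i : X ⟶ Y), K.Conflation i p

/-- A morphism is admissible if it is a deflation followed by an inflation. -/
def Admissible {X Y : C} (f : X ⟶ Y) : Prop :=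
  ∃ (I : C) (p : X ⟶ I) (i : I ⟶ Y), K.Deflation p ∧ K.Inflation i ∧ p ≫ i = f

/-- The class of sequences in `D` which are isomorphic to the image under `F` of a
conflation in `C`. -/
def image {D : Type u'} [Category.{v'} D] (F : C ⥤ D) : SequenceClass D where
  Conflation {X Y Z} f g :=
    ∃ (X' Y' Z' : C) (f' : X' ⟶ Y') (g' : Y' ⟶ Z')
      (a : F.obj X' ≅ X) (b : F.obj Y' ≅ Y) (c : F.obj Z' ≅ Z),
      K.Conflation f' g' ∧ F.map f' ≫ b.hom = a.hom ≫ f ∧ F.map g' ≫ c.hom = b.hom ≫ g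

/-- `(C, K)` is a conflation category: `K` is a class of kernel-cokernel pairs, closed under
isomorphisms. -/
structure IsConflationStructure [Preadditive C] : Prop where
  kernel_cokernel {X Y Z : C} {f : X ⟶ Y} {g : Y ⟶ Z} (h : K.Conflation f g) :
    ∃ w : f ≫ g = 0, Nonempty (IsLimit (KernelFork.ofι f w)) ∧
      Nonempty (IsColimit (CokernelCofork.ofπ g w))
  of_iso {X Y Z X' Y' Z' : C} {f : X ⟶ Y} {g : Y ⟶ Z} {f' : X' ⟶ Y'} {g' : Y' ⟶ Z'}
    (a : X ≅ X') (b : Y ≅ Y') (c : Z ≅ Z')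
    (hf : f ≫ b.hom = a.hom ≫ f') (hg : g ≫ c.hom = b.hom ≫ g')
    (h : K.Conflation f g) : K.Conflation f' g'

/-- `(C, K)` is an exact category in the sense of Quillen (the underlying category being
additive). -/
structure IsExactStructure [Preadditive C] [HasFiniteBiproducts C] : Prop
    extends K.IsConflationStructure where
  deflation_to_zero (X Z : C) (hZ : IsZero Z) : K.Deflation (0 : X ⟶ Z)
  deflation_comp {X Y Z : C} {p : X ⟶ Y} {q : Y ⟶ Z} :
    K.Deflation p → K.Deflation q → K.Deflation (p ≫ q)
  hasPullback {X Y Z : C} (p : X ⟶ Z) (g : Y ⟶ Z) : K.Deflation p → HasPullback p g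
  deflation_of_isPullback {P X Y Z : C} {fst : P ⟶ X} {snd : P ⟶ Y} {p : X ⟶ Z} {g : Y ⟶ Z} :
    IsPullback fst snd p g → K.Deflation p → K.Deflation snd
  inflation_from_zero (Z X : C) (hZ : IsZero Z) : K.Inflation (0 : Z ⟶ X)
  inflation_comp {X Y Z : C} {i : X ⟶ Y} {j : Y ⟶ Z} :
    K.Inflation i → K.Inflation j → K.Inflation (i ≫ j)
  hasPushout {X Y Z : C} (i : Z ⟶ X) (g : Z ⟶ Y) : K.Inflation i → HasPushout i g
  inflation_of_isPushout {P X Y Z : C} {i : Z ⟶ X} {g : Z ⟶ Y} {inl : X ⟶ P} {inr : Y ⟶ P} :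
    IsPushout i g inl inr → K.Inflation i → K.Inflation inr

/-- The full subcategory `A` is nonempty and a Serre subcategory. -/
structure IsSerreSubcategory (A : ObjectProperty C) : Prop where
  nonempty : ∃ X, A X
  serre {X Y Z : C} {f : X ⟶ Y} {g : Y ⟶ Z} : K.Conflation f g → (A Y ↔ A X ∧ A Z)

/-- Admissibly deflation-percolating subcategories: Serre subcategories `A` such that every
morphism to an object of `A` is admissible with image in `A`. -/
structure IsDeflationPercolating (A : ObjectProperty C) : Prop
    extends K.IsSerreSubcategory A where
  admissible_to {X T : C} (f : X ⟶ T) : A T →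
    ∃ (I : C) (p : X ⟶ I) (i : I ⟶ T), K.Deflation p ∧ K.Inflation i ∧ p ≫ i = f ∧ A I

/-- Admissibly inflation-percolating subcategories: Serre subcategories `A` such that every
morphism from an object of `A` is admissible with image in `A`. -/
structure IsInflationPercolating (A : ObjectProperty C) : Prop
    extends K.IsSerreSubcategory A where
  admissible_from {T X : C} (f : T ⟶ X) : A T →
    ∃ (I : C) (p : T ⟶ I) (i : I ⟶ X), K.Deflation p ∧ K.Inflation i ∧ p ≫ i = f ∧ A I

/-- Two-sided admissibly percolating subcategories. -/
structure IsTwoSidedPercolating (A : ObjectProperty C) : Prop where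
  deflationPercolating : K.IsDeflationPercolating A
  inflationPercolating : K.IsInflationPercolating A

/-- The weak `A`-isomorphisms: admissible morphisms with kernel and cokernel in `A`. -/
def weakIsomorphisms [Preadditive C] (A : ObjectProperty C) : MorphismProperty C :=
  fun X Y f => K.Admissible f ∧
    (∃ (N : C) (k : N ⟶ X) (w : k ≫ f = 0), Nonempty (IsLimit (KernelFork.ofι k w)) ∧ A N) ∧
    (∃ (N : C) (c : Y ⟶ N) (w : f ≫ c = 0), Nonempty (IsColimit (CokernelCofork.ofπ c w)) ∧ A N)

end SequenceClass

end PercolatingQuotient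

open scoped ZeroObject

namespace PercolatingQuotient

namespace SequenceClass

/-! ### Opposite classes and pullback squares. -/

section Basic

variable {C : Type u} [Category.{v} C] {K : SequenceClass C}

lemma Conflation.inflation {X Y Z : C} {f : X ⟶ Y} {g : Y ⟶ Z} (h : K.Conflation f g) :
    K.Inflation f := ⟨_, _, h⟩

lemma Conflation.deflation {X Y Z : C} {f : X ⟶ Y} {g : Y ⟶ Z} (h : K.Conflation f g) :
    K.Deflation g := ⟨_, _, h⟩

/-- The opposite class of sequences. -/
def op (K : SequenceClass C) : SequenceClass Cᵒᵖ where
  Conflation f g := K.Conflation g.unop f.unop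

lemma op_deflation_iff {X Y : Cᵒᵖ} {f : X ⟶ Y} : K.op.Deflation f ↔ K.Inflation f.unop :=
  ⟨fun ⟨Z, g, h⟩ => ⟨Z.unop, g.unop, h⟩, fun ⟨Z, g, h⟩ => ⟨.op Z, g.op, h⟩⟩

lemma op_inflation_iff {X Y : Cᵒᵖ} {f : X ⟶ Y} : K.op.Inflation f ↔ K.Deflation f.unop :=
  ⟨fun ⟨Z, g, h⟩ => ⟨Z.unop, g.unop, h⟩, fun ⟨Z, g, h⟩ => ⟨.op Z, g.op, h⟩⟩

lemma op_admissible_iff {X Y : Cᵒᵖ} {f : X ⟶ Y} : K.op.Admissible f ↔ K.Admissible f.unop := by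
  constructor
  · rintro ⟨I, p, i, hp, hi, rfl⟩
    exact ⟨I.unop, i.unop, p.unop, op_inflation_iff.1 hi, op_deflation_iff.1 hp, rfl⟩
  · rintro ⟨I, p, i, hp, hi, h⟩
    exact ⟨.op I, i.op, p.op, op_deflation_iff.2 hi, op_inflation_iff.2 hp,
      Quiver.Hom.unop_inj h⟩

/-- A commutative square with the existence and uniqueness properties of a pullback. -/
lemma isPullback_of_exists {P X Y Z : C} {fst : P ⟶ X} {snd : P ⟶ Y} {f : X ⟶ Z} {g : Y ⟶ Z}
    (w : fst ≫ f = snd ≫ g)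
    (uniq : ∀ {T : C} (a b : T ⟶ P), a ≫ fst = b ≫ fst → a ≫ snd = b ≫ snd → a = b)
    (ex : ∀ {T : C} (a : T ⟶ X) (b : T ⟶ Y), a ≫ f = b ≫ g →
      ∃ l : T ⟶ P, l ≫ fst = a ∧ l ≫ snd = b) : IsPullback fst snd f g := by
  refine ⟨⟨w⟩, ⟨PullbackCone.IsLimit.mk w (fun s => (ex s.fst s.snd s.condition).choose)
    (fun s => (ex s.fst s.snd s.condition).choose_spec.1)
    (fun s => (ex s.fst s.snd s.condition).choose_spec.2) ?_⟩⟩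
  intro s m h₁ h₂
  exact uniq _ _ (h₁.trans (ex s.fst s.snd s.condition).choose_spec.1.symm)
    (h₂.trans (ex s.fst s.snd s.condition).choose_spec.2.symm)

end Basic

/-! ### Conflations as kernel-cokernel pairs. -/

section Conflation

variable {C : Type u} [Category.{v} C] [Preadditive C] {K : SequenceClass C}

namespace IsConflationStructure

variable (hK : K.IsConflationStructure)
include hK

lemma zero {X Y Z : C} {f : X ⟶ Y} {g : Y ⟶ Z} (h : K.Conflation f g) : f ≫ g = 0 :=
  (hK.kernel_cokernel h).choose

lemma mono {X Y Z : C} {f : X ⟶ Y} {g : Y ⟶ Z} (h : K.Conflation f g) : Mono f := by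
  obtain ⟨w, ⟨hl⟩, -⟩ := hK.kernel_cokernel h
  exact mono_of_isLimit_fork hl

lemma epi {X Y Z : C} {f : X ⟶ Y} {g : Y ⟶ Z} (h : K.Conflation f g) : Epi g := by
  obtain ⟨w, -, ⟨hl⟩⟩ := hK.kernel_cokernel h
  exact epi_of_isColimit_cofork hl

lemma exists_lift {X Y Z T : C} {f : X ⟶ Y} {g : Y ⟶ Z} (h : K.Conflation f g)
    (k : T ⟶ Y) (hk : k ≫ g = 0) : ∃ l : T ⟶ X, l ≫ f = k := by
  obtain ⟨w, ⟨hl⟩, -⟩ := hK.kernel_cokernel h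
  exact ⟨_, (KernelFork.IsLimit.lift' hl k hk).2⟩

lemma exists_desc {X Y Z T : C} {f : X ⟶ Y} {g : Y ⟶ Z} (h : K.Conflation f g)
    (k : Y ⟶ T) (hk : f ≫ k = 0) : ∃ l : Z ⟶ T, g ≫ l = k := by
  obtain ⟨w, -, ⟨hl⟩⟩ := hK.kernel_cokernel h
  exact ⟨_, (CokernelCofork.IsColimit.desc' hl k hk).2⟩

lemma op : K.op.IsConflationStructure where
  kernel_cokernel {X Y Z f g} h := by
    obtain ⟨w, ⟨h₁⟩, ⟨h₂⟩⟩ := hK.kernel_cokernel (K := K) h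
    exact ⟨Quiver.Hom.unop_inj w, ⟨CokernelCofork.IsColimit.ofπOp _ _ h₂⟩,
      ⟨KernelFork.IsLimit.ofιOp _ _ h₁⟩⟩
  of_iso a b c hf hg h :=
    have hg' : b.inv ≫ _ = _ ≫ c.inv := by
      rw [Iso.inv_comp_eq, ← Category.assoc, ← hg, Category.assoc, Iso.hom_inv_id, Category.comp_id]
    have hf' : a.inv ≫ _ = _ ≫ b.inv := by
      rw [Iso.inv_comp_eq, ← Category.assoc, ← hf, Category.assoc, Iso.hom_inv_id, Category.comp_id]
    hK.of_iso c.unop.symm b.unop.symm a.unop.symm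
      (congr_arg Quiver.Hom.unop hg') (congr_arg Quiver.Hom.unop hf') h

lemma mono_of_inflation {X Y : C} {f : X ⟶ Y} (h : K.Inflation f) : Mono f :=
  hK.mono h.choose_spec.choose_spec

/-- A deflation together with any kernel of it is a conflation. -/
lemma conflation_of_kernel {X Y Z : C} {f : X ⟶ Y} {g : Y ⟶ Z} (hg : K.Deflation g) (hf : Mono f)
    (w : f ≫ g = 0) (hl : ∀ {T : C} (k : T ⟶ Y), k ≫ g = 0 → ∃ l : T ⟶ X, l ≫ f = k) :
    K.Conflation f g := by
  obtain ⟨X', f', h⟩ := hg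
  have := hK.mono h
  obtain ⟨a, ha⟩ := hK.exists_lift h f w
  obtain ⟨b, hb⟩ := hl f' (hK.zero h)
  refine hK.of_iso (Iso.mk b a ?_ ?_) (Iso.refl _) (Iso.refl _) ?_ ?_ h
  · simp [← cancel_mono f', ha, hb]
  · simp [← cancel_mono f, ha, hb]
  · simp [hb]
  · simp

/-- A kernel of `g ≫ c` is a base change of a kernel of `c`. -/
lemma isPullback_of_conflation {X Y Z X' Y' : C} {i : X ⟶ Y} {c : Y ⟶ Z} (h : K.Conflation i c)
    {g : Y' ⟶ Y} {i' : X' ⟶ Y'} (h' : K.Conflation i' (g ≫ c)) {k : X' ⟶ X}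
    (w : k ≫ i = i' ≫ g) : IsPullback k i' i g := by
  have := hK.mono h
  have := hK.mono h'
  refine isPullback_of_exists w (fun a b _ hb => by rwa [cancel_mono] at hb) ?_
  intro T a b hab
  obtain ⟨l, hl⟩ := hK.exists_lift h' b (by rw [← reassoc_of% hab, hK.zero h, comp_zero])
  exact ⟨l, by rw [← cancel_mono i, hab, ← hl, Category.assoc, w, Category.assoc], hl⟩

/-- The kernel of a base change of a deflation is the kernel of the deflation. -/
lemma conflation_of_isPullback {P X Y Z N : C} {fst : P ⟶ X} {snd : P ⟶ Y} {p : X ⟶ Z} {g : Y ⟶ Z}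
    (h : IsPullback fst snd p g) (hs : K.Deflation snd) {k : N ⟶ X} (hk : K.Conflation k p) :
    ∃ k' : N ⟶ P, k' ≫ fst = k ∧ K.Conflation k' snd := by
  have := hK.mono hk
  refine ⟨h.lift k 0 (by simp [hK.zero hk]), by simp, ?_⟩
  refine hK.conflation_of_kernel hs (mono_of_mono_fac (h.lift_fst _ _ _)) (by simp) ?_
  intro T a ha
  obtain ⟨l, hl⟩ := hK.exists_lift hk (a ≫ fst) (by rw [Category.assoc, h.w, reassoc_of% ha, zero_comp])
  exact ⟨l, h.hom_ext (by simp [hl]) (by simp [ha])⟩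

lemma isIso_of_mono {X I : C} {p : X ⟶ I} (hp : K.Deflation p) (h : Mono p) : IsIso p := by
  obtain ⟨N, k, hk⟩ := hp
  have := hK.epi hk
  obtain ⟨l, hl⟩ := hK.exists_desc hk (𝟙 X)
    (by rw [Category.comp_id]; exact zero_of_comp_mono p (hK.zero hk))
  exact ⟨l, hl, by simp [← cancel_epi p, reassoc_of% hl]⟩

end IsConflationStructure

end Conflation

/-! ### Base change and composition in exact categories. -/

section Exact

variable {C : Type u} [Category.{v} C] [Preadditive C] [HasFiniteBiproducts C]
  {K : SequenceClass C}

instance : HasFiniteBiproducts Cᵒᵖ := HasFiniteBiproducts.of_hasFiniteProducts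

namespace IsExactStructure

variable (hK : K.IsExactStructure)
include hK

/-- The axioms are self-dual; statements about inflations and cokernels are obtained from those
about deflations and kernels through this lemma. -/
lemma op : K.op.IsExactStructure where
  toIsConflationStructure := hK.toIsConflationStructure.op
  deflation_to_zero X Z hZ := op_deflation_iff.2 (hK.inflation_from_zero _ _ hZ.unop)
  deflation_comp hp hq := op_deflation_iff.2
    (hK.inflation_comp (op_deflation_iff.1 hq) (op_deflation_iff.1 hp))
  hasPullback p g hp := by
    have := hK.hasPushout p.unop g.unop (op_deflation_iff.1 hp)
    exact (IsPushout.of_hasPushout p.unop g.unop).op.flip.hasPullback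
  deflation_of_isPullback h hp := op_deflation_iff.2
    (hK.inflation_of_isPushout h.unop.flip (op_deflation_iff.1 hp))
  inflation_from_zero Z X hZ := op_inflation_iff.2 (hK.deflation_to_zero _ _ hZ.unop)
  inflation_comp hp hq := op_inflation_iff.2
    (hK.deflation_comp (op_inflation_iff.1 hq) (op_inflation_iff.1 hp))
  hasPushout p g hp := by
    have := hK.hasPullback p.unop g.unop (op_inflation_iff.1 hp)
    exact (IsPullback.of_hasPullback p.unop g.unop).op.flip.hasPushout
  inflation_of_isPushout h hp := op_inflation_iff.2
    (hK.deflation_of_isPullback h.unop.flip (op_inflation_iff.1 hp))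

lemma conflation_isIso {X Y Z : C} (e : X ⟶ Y) [IsIso e] (hZ : IsZero Z) :
    K.Conflation e (0 : Y ⟶ Z) := by
  refine hK.conflation_of_kernel (hK.deflation_to_zero _ _ hZ) inferInstance (by simp) ?_
  exact fun k _ => ⟨k ≫ inv e, by simp⟩

lemma inflation_isIso {X Y : C} (e : X ⟶ Y) [IsIso e] : K.Inflation e := by
  have : HasZeroObject C := hasZeroObject_of_hasFiniteBiproducts C
  exact (hK.conflation_isIso e (isZero_zero C)).inflation

lemma isIso_conflation {X Y Z : C} (e : X ⟶ Y) [IsIso e] (hZ : IsZero Z) :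
    K.Conflation (0 : Z ⟶ X) e :=
  hK.op.conflation_isIso e.op hZ.op

lemma deflation_isIso {X Y : C} (e : X ⟶ Y) [IsIso e] : K.Deflation e := by
  have : HasZeroObject C := hasZeroObject_of_hasFiniteBiproducts C
  exact (hK.isIso_conflation e (isZero_zero C)).deflation

/-- Base change of a conflation along a morphism to its last term. -/
lemma exists_baseChange {N X Z Y : C} {k : N ⟶ X} {p : X ⟶ Z} (h : K.Conflation k p) (g : Y ⟶ Z) :
    ∃ (P : C) (fst : P ⟶ X) (snd : P ⟶ Y) (k' : N ⟶ P), IsPullback fst snd p g ∧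
      k' ≫ fst = k ∧ K.Conflation k' snd := by
  have := hK.hasPullback p g h.deflation
  have hP := IsPullback.of_hasPullback p g
  obtain ⟨k', h₁, h₂⟩ := hK.conflation_of_isPullback hP (hK.deflation_of_isPullback hP h.deflation) h
  exact ⟨_, _, _, k', hP, h₁, h₂⟩

/-- The kernel of a composite of deflations is an extension of the kernels. -/
lemma exists_conflation_comp {N X Y L Z : C} {k : N ⟶ X} {p : X ⟶ Y} {l : L ⟶ Y} {q : Y ⟶ Z}
    (hp : K.Conflation k p) (hq : K.Conflation l q) :
    ∃ (M : C) (m : M ⟶ X) (k' : N ⟶ M) (r : M ⟶ L), K.Conflation m (p ≫ q) ∧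
      K.Conflation k' r ∧ k' ≫ m = k ∧ m ≫ p = r ≫ l := by
  obtain ⟨M, m, r, k', hP, h₁, h₂⟩ := hK.exists_baseChange hp l
  have := hK.mono hq
  have : Mono m := ⟨fun a b hab => hP.hom_ext hab (by
    rw [← cancel_mono l, Category.assoc, Category.assoc, ← hP.w, reassoc_of% hab])⟩
  refine ⟨M, m, k', r, hK.conflation_of_kernel
    (hK.deflation_comp hp.deflation hq.deflation) this ?_ ?_, h₂, h₁, hP.w⟩
  · rw [reassoc_of% hP.w, hK.zero hq, comp_zero]
  · intro T a ha
    obtain ⟨b, hb⟩ := hK.exists_lift hq (a ≫ p) (by simpa using ha)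
    exact ⟨hP.lift a b hb.symm, by simp⟩

/-- The cokernel of a composite of inflations is an extension of the cokernels. -/
lemma exists_comp_conflation {X Y Z M N : C} {i : X ⟶ Y} {c : Y ⟶ M} {j : Y ⟶ Z} {d : Z ⟶ N}
    (hi : K.Conflation i c) (hj : K.Conflation j d) :
    ∃ (P : C) (m : Z ⟶ P) (l : M ⟶ P) (r : P ⟶ N), K.Conflation (i ≫ j) m ∧
      K.Conflation l r ∧ m ≫ r = d ∧ j ≫ m = c ≫ l := by
  obtain ⟨P, m, r, l, h₁, h₂, h₃, h₄⟩ :=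
    hK.op.exists_conflation_comp (k := d.op) (p := j.op) (l := c.op) (q := i.op) hj hi
  exact ⟨P.unop, m.unop, l.unop, r.unop, h₁, h₂, Quiver.Hom.op_inj h₃, Quiver.Hom.op_inj h₄⟩

/-- A morphism of conflations which is an isomorphism on kernels has a cartesian right square. -/
lemma isPullback_of_conflations {W X C' Y B : C} {w : W ⟶ X} {x : X ⟶ C'} {w' : W ⟶ Y} {y : Y ⟶ B}
    (h : K.Conflation w x) (h' : K.Conflation w' y) {φ : X ⟶ Y} {β : C' ⟶ B}
    (hw : w ≫ φ = w') (hφ : φ ≫ y = x ≫ β) : IsPullback x φ β y := by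
  have := hK.mono h'
  have uniq : ∀ {T : C} (a : T ⟶ X), a ≫ x = 0 → a ≫ φ = 0 → a = 0 := by
    intro T a h₁ h₂
    obtain ⟨l, rfl⟩ := hK.exists_lift h a h₁
    rw [Category.assoc, hw] at h₂
    rw [zero_of_comp_mono w' h₂, zero_comp]
  refine isPullback_of_exists hφ.symm ?_ ?_
  · intro T a b h₁ h₂
    rw [← sub_eq_zero]
    exact uniq _ (by simp [h₁]) (by simp [h₂])
  · intro T c b hcb
    -- The lift is first found on the cover `t : P ⟶ T`. There `a` has the right image under `x`,
    -- and its error under `φ` comes from `W`; the corrected map kills the kernel `n` of `t`, so it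
    -- descends to `T`.
    obtain ⟨P, a, t, n, hP, -, hn⟩ := hK.exists_baseChange h c
    obtain ⟨l, hl⟩ := hK.exists_lift h' (t ≫ b - a ≫ φ) (by
      simp [← hcb, hφ, reassoc_of% hP.w])
    obtain ⟨e, he⟩ := hK.exists_desc hn (a + l ≫ w) (uniq _ (by
      simp [hK.zero h, hP.w, reassoc_of% (hK.zero hn)]) (by
      simp [hw, hl, reassoc_of% (hK.zero hn)]))
    have := hK.epi hn
    refine ⟨e, ?_, ?_⟩
    · rw [← cancel_epi t, reassoc_of% he]
      simp [hK.zero h, hP.w]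
    · rw [← cancel_epi t, reassoc_of% he]
      simp [hw, hl]

lemma exists_iso_of_conflation {X Y Z Z' : C} {f : X ⟶ Y} {g : Y ⟶ Z} {g' : Y ⟶ Z'}
    (h : K.Conflation f g) (h' : K.Conflation f g') : ∃ e : Z ≅ Z', g ≫ e.hom = g' := by
  have := hK.epi h
  have := hK.epi h'
  obtain ⟨a, ha⟩ := hK.exists_desc h g' (hK.zero h')
  obtain ⟨b, hb⟩ := hK.exists_desc h' g (hK.zero h)
  exact ⟨⟨a, b, by simp [← cancel_epi g, reassoc_of% ha, hb],
    by simp [← cancel_epi g', reassoc_of% hb, ha]⟩, ha⟩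

end IsExactStructure

end Exact

/-! ### Objects of `A` and weak isomorphisms. -/

section Percolating

variable {C : Type u} [Category.{v} C] [Preadditive C] [HasFiniteBiproducts C]
  {K : SequenceClass C} {A : ObjectProperty C}

omit [Preadditive C] [HasFiniteBiproducts C] in
lemma IsSerreSubcategory.op (hA : K.IsSerreSubcategory A) : K.op.IsSerreSubcategory A.op where
  nonempty := ⟨.op hA.nonempty.choose, hA.nonempty.choose_spec⟩
  serre h := (hA.serre (K := K) h).trans and_comm

namespace IsTwoSidedPercolating

omit [Preadditive C] [HasFiniteBiproducts C] in
lemma op (hA : K.IsTwoSidedPercolating A) : K.op.IsTwoSidedPercolating A.op where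
  deflationPercolating :=
    { toIsSerreSubcategory := hA.deflationPercolating.toIsSerreSubcategory.op
      admissible_to := fun f hT => by
        obtain ⟨I, p, i, hp, hi, h, hI⟩ := hA.inflationPercolating.admissible_from f.unop hT
        exact ⟨.op I, i.op, p.op, op_deflation_iff.2 hi, op_inflation_iff.2 hp,
          Quiver.Hom.unop_inj h, hI⟩ }
  inflationPercolating :=
    { toIsSerreSubcategory := hA.deflationPercolating.toIsSerreSubcategory.op
      admissible_from := fun f hT => by
        obtain ⟨I, p, i, hp, hi, h, hI⟩ := hA.deflationPercolating.admissible_to f.unop hT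
        exact ⟨.op I, i.op, p.op, op_deflation_iff.2 hi, op_inflation_iff.2 hp,
          Quiver.Hom.unop_inj h, hI⟩ }

variable (hA : K.IsTwoSidedPercolating A)
include hA

omit [Preadditive C] [HasFiniteBiproducts C] in
lemma serre {X Y Z : C} {f : X ⟶ Y} {g : Y ⟶ Z} (h : K.Conflation f g) : A Y ↔ A X ∧ A Z :=
  hA.deflationPercolating.serre h

omit [Preadditive C] [HasFiniteBiproducts C] in
lemma exists_to {X T : C} (f : X ⟶ T) (hT : A T) :
    ∃ (N I L : C) (k : N ⟶ X) (p : X ⟶ I) (i : I ⟶ T) (c : T ⟶ L), K.Conflation k p ∧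
      K.Conflation i c ∧ p ≫ i = f ∧ A I ∧ A L := by
  obtain ⟨I, p, i, ⟨N, k, hk⟩, ⟨L, c, hc⟩, h, hI⟩ := hA.deflationPercolating.admissible_to f hT
  exact ⟨N, I, L, k, p, i, c, hk, hc, h, hI, ((hA.serre hc).1 hT).2⟩

omit [Preadditive C] [HasFiniteBiproducts C] in
lemma exists_from {T X : C} (f : T ⟶ X) (hT : A T) :
    ∃ (N I L : C) (k : N ⟶ T) (p : T ⟶ I) (i : I ⟶ X) (c : X ⟶ L), K.Conflation k p ∧
      K.Conflation i c ∧ p ≫ i = f ∧ A I ∧ A N := by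
  obtain ⟨I, p, i, ⟨N, k, hk⟩, ⟨L, c, hc⟩, h, hI⟩ := hA.inflationPercolating.admissible_from f hT
  exact ⟨N, I, L, k, p, i, c, hk, hc, h, hI, ((hA.serre hk).1 hT).1⟩

variable (hK : K.IsExactStructure)
include hK

lemma of_isZero {Z : C} (hZ : IsZero Z) : A Z := by
  obtain ⟨X, hX⟩ := hA.deflationPercolating.nonempty
  exact ((hA.serre (hK.conflation_isIso (𝟙 X) hZ)).1 hX).2

lemma of_iso {X Y : C} (e : X ≅ Y) (hX : A X) : A Y := by
  have : HasZeroObject C := hasZeroObject_of_hasFiniteBiproducts C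
  exact (hA.serre (hK.conflation_isIso e.hom (isZero_zero C))).2
    ⟨hX, hA.of_isZero hK (isZero_zero C)⟩

/-- A monomorphism to an object of `A` is an inflation from an object of `A`. -/
lemma of_mono {X T : C} (f : X ⟶ T) (hf : Mono f) (hT : A T) : A X ∧ K.Inflation f := by
  obtain ⟨N, I, L, k, p, i, c, hk, hc, rfl, hI, hL⟩ := hA.exists_to f hT
  have := hK.isIso_of_mono hk.deflation (mono_of_mono p i)
  exact ⟨hA.of_iso hK (asIso p).symm hI, hK.inflation_comp (hK.inflation_isIso p) hc.inflation⟩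

/-- A monomorphism from an object of `A` is an inflation. -/
lemma inflation_of_mono {X T : C} (f : T ⟶ X) (hf : Mono f) (hT : A T) : K.Inflation f := by
  obtain ⟨N, I, L, k, p, i, c, hk, hc, rfl, hI, hL⟩ := hA.exists_from f hT
  have := hK.isIso_of_mono hk.deflation (mono_of_mono p i)
  exact hK.inflation_comp (hK.inflation_isIso p) hc.inflation

lemma of_epi {X T : C} (f : T ⟶ X) (_ : Epi f) (hT : A T) : A X :=
  (hA.op.of_mono hK.op f.op inferInstance hT).1

lemma deflation_of_epi {X T : C} (f : X ⟶ T) (_ : Epi f) (hT : A T) : K.Deflation f :=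
  op_inflation_iff.1 (hA.op.inflation_of_mono hK.op f.op inferInstance hT)

/-- The kernel of the deflation part embeds in any categorical kernel of `f`, and dually for
cokernels, so `A` can be tested on the factorization itself. -/
lemma weakIsomorphisms_iff {X Y : C} (f : X ⟶ Y) : K.weakIsomorphisms A f ↔
    ∃ (N I L : C) (k : N ⟶ X) (p : X ⟶ I) (i : I ⟶ Y) (c : Y ⟶ L), K.Conflation k p ∧
      K.Conflation i c ∧ p ≫ i = f ∧ A N ∧ A L := by
  constructor
  · rintro ⟨⟨I, p, i, ⟨N, k, hk⟩, ⟨L, c, hc⟩, rfl⟩, ⟨N', k', w, ⟨hl⟩, hN⟩, ⟨L', c', w', ⟨hl'⟩, hL⟩⟩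
    have := mono_of_isLimit_fork hl
    have := epi_of_isColimit_cofork hl'
    have := hK.mono hk
    have := hK.epi hk
    have := hK.mono hc
    have := hK.epi hc
    refine ⟨N, I, L, k, p, i, c, hk, hc, rfl, ?_, ?_⟩
    · obtain ⟨l, h⟩ := KernelFork.IsLimit.lift' hl k (by rw [reassoc_of% hK.zero hk, zero_comp])
      exact (hA.of_mono hK l (mono_of_mono_fac h) hN).1
    · obtain ⟨l, h⟩ := CokernelCofork.IsColimit.desc' hl' c
        (by rw [Category.assoc, hK.zero hc, comp_zero])
      exact hA.of_epi hK l (epi_of_epi_fac h) hL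
  · rintro ⟨N, I, L, k, p, i, c, hk, hc, rfl, hN, hL⟩
    have := hK.mono hk
    have := hK.epi hk
    have := hK.mono hc
    have := hK.epi hc
    refine ⟨⟨I, p, i, hk.deflation, hc.inflation, rfl⟩,
      ⟨N, k, by rw [reassoc_of% hK.zero hk, zero_comp], ?_, hN⟩,
      ⟨L, c, by rw [Category.assoc, hK.zero hc, comp_zero], ?_, hL⟩⟩
    · obtain ⟨w, ⟨hl⟩, -⟩ := hK.kernel_cokernel hk
      exact ⟨isKernelCompMono hl i rfl⟩
    · obtain ⟨w, -, ⟨hl⟩⟩ := hK.kernel_cokernel hc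
      exact ⟨isCokernelEpiComp hl p rfl⟩

lemma weakIsomorphisms_deflation {N X Y : C} {k : N ⟶ X} {p : X ⟶ Y} (h : K.Conflation k p)
    (hN : A N) : K.weakIsomorphisms A p := by
  have : HasZeroObject C := hasZeroObject_of_hasFiniteBiproducts C
  exact (hA.weakIsomorphisms_iff hK p).2 ⟨N, Y, 0, k, p, 𝟙 Y, 0, h,
    hK.conflation_isIso (𝟙 Y) (isZero_zero C), by simp, hN, hA.of_isZero hK (isZero_zero C)⟩

lemma weakIsomorphisms_inflation {L X Y : C} {i : X ⟶ Y} {c : Y ⟶ L} (h : K.Conflation i c)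
    (hL : A L) : K.weakIsomorphisms A i := by
  have : HasZeroObject C := hasZeroObject_of_hasFiniteBiproducts C
  exact (hA.weakIsomorphisms_iff hK i).2 ⟨0, X, L, 0, 𝟙 X, i, c,
    hK.isIso_conflation (𝟙 X) (isZero_zero C), h, by simp, hA.of_isZero hK (isZero_zero C), hL⟩

lemma op_weakIsomorphisms : K.op.weakIsomorphisms A.op = (K.weakIsomorphisms A).op := by
  ext X Y f
  refine (hA.op.weakIsomorphisms_iff hK.op f).trans
    (Iff.trans ?_ (hA.weakIsomorphisms_iff hK f.unop).symm)
  constructor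
  · rintro ⟨N, I, L, k, p, i, c, hk, hc, rfl, hN, hL⟩
    exact ⟨L.unop, I.unop, N.unop, c.unop, i.unop, p.unop, k.unop, hc, hk, rfl, hL, hN⟩
  · rintro ⟨N, I, L, k, p, i, c, hk, hc, h, hN, hL⟩
    exact ⟨.op L, .op I, .op N, c.op, i.op, p.op, k.op, hc, hk, Quiver.Hom.unop_inj h, hL, hN⟩

/-! ### Interchange of inflations and deflations, and composition. -/

/-- An inflation with cokernel in `A` followed by a deflation is also a deflation followed by an
inflation with cokernel in `A`. -/
lemma exists_inflation_comp_deflation {X Y L N Z : C} {i : X ⟶ Y} {c : Y ⟶ L} {n : N ⟶ Y}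
    {p : Y ⟶ Z} (hi : K.Conflation i c) (hL : A L) (hp : K.Conflation n p) :
    ∃ (M I L' : C) (m : M ⟶ X) (d : X ⟶ I) (κ : I ⟶ Z) (z : Z ⟶ L'), K.Conflation m d ∧
      K.Conflation κ z ∧ d ≫ κ = i ≫ p ∧ A L' ∧ (A N → A M) := by
  obtain ⟨M, B, L', m₀, b, j, c', hb, hj, hbj, hB, hL'⟩ := hA.exists_to (n ≫ c) hL
  have := hK.epi hi
  have := hK.epi hb
  have := hK.epi hj
  have := hK.mono hj
  have hpz : n ≫ c ≫ c' = 0 := by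
    rw [← reassoc_of% hbj, hK.zero hj, comp_zero]
  obtain ⟨z, hz⟩ := hK.exists_desc hp (c ≫ c') hpz
  obtain ⟨I, κ, hκ⟩ := hA.deflation_of_epi hK z (epi_of_epi_fac hz) hL'
  -- Passing to `Y'`, the kernel of `c ≫ c'`, replaces `N ⟶ L` by the deflation `b : N ⟶ B`. It
  -- remains to see that `x ≫ π` is a deflation with kernel `M`.
  obtain ⟨Y', y', x, r, hy', hx, hxy, hyc⟩ := hK.exists_conflation_comp hi hj
  obtain ⟨π, hπ⟩ := hK.exists_lift hκ (y' ≫ p) (by rw [Category.assoc, hz, hK.zero hy'])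
  have hP := (hK.isPullback_of_conflation hκ (by rwa [hz]) hπ).flip
  obtain ⟨n', hn', hnπ⟩ := hK.conflation_of_isPullback hP
    (hK.deflation_of_isPullback hP hp.deflation) hp
  have := hK.epi hnπ
  have hnr : n' ≫ r = b := by
    rw [← cancel_mono j, Category.assoc, ← hyc, reassoc_of% hn', hbj]
  -- `V` is the quotient of `Y'` by `M`, an extension of `I` by `B`. The map `ρ` induced by `r`
  -- splits it, with section `δ` of `σ`, and `x ≫ π` is the base change of `q` along `δ`.
  obtain ⟨V, q, τ, σ, hq, hτ, hqσ, hnq⟩ := hK.exists_comp_conflation hb hnπ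
  obtain ⟨ρ, hρ⟩ := hK.exists_desc hq r (by rw [Category.assoc, hnr, hK.zero hb])
  have hτρ : τ ≫ ρ = 𝟙 B := by
    rw [← cancel_epi b, ← reassoc_of% hnq, hρ, hnr, Category.comp_id]
  obtain ⟨δ, hδ⟩ := hK.exists_desc hnπ (q - r ≫ τ) (by simp [hnq, reassoc_of% hnr])
  have hδρ : δ ≫ ρ = 0 := by
    rw [← cancel_epi π, reassoc_of% hδ]
    simp [hρ, hτρ]
  have hδσ : δ ≫ σ = 𝟙 I := by
    rw [← cancel_epi π, reassoc_of% hδ]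
    simp [hqσ, hK.zero hτ]
  have hsq : IsPullback x (x ≫ π) q δ := by
    have := hK.mono hx
    refine isPullback_of_exists (by simp [hδ, reassoc_of% (hK.zero hx)])
      (fun a b h _ => by rwa [cancel_mono] at h) ?_
    intro T a b hab
    obtain ⟨l, rfl⟩ := hK.exists_lift hx a (by rw [← hρ, reassoc_of% hab, hδρ, comp_zero])
    refine ⟨l, rfl, ?_⟩
    have h := congr_arg (· ≫ σ) hab
    simpa [hqσ, hδσ] using h
  obtain ⟨m, -, hm⟩ := hK.conflation_of_isPullback hsq
    (hK.deflation_of_isPullback hsq hq.deflation) hq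
  exact ⟨M, I, L', m, x ≫ π, κ, z, hm, hκ, by rw [Category.assoc, hπ, reassoc_of% hxy], hL',
    fun hN => ((hA.serre hb).1 hN).1⟩

lemma weakIsomorphisms_comp {X Y Z : C} {s : X ⟶ Y} {t : Y ⟶ Z} (hs : K.weakIsomorphisms A s)
    (ht : K.weakIsomorphisms A t) : K.weakIsomorphisms A (s ≫ t) := by
  obtain ⟨N₁, I₁, L₁, k₁, p₁, i₁, c₁, hk₁, hc₁, rfl, hN₁, hL₁⟩ :=
    (hA.weakIsomorphisms_iff hK s).1 hs
  obtain ⟨N₂, I₂, L₂, k₂, p₂, i₂, c₂, hk₂, hc₂, rfl, hN₂, hL₂⟩ :=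
    (hA.weakIsomorphisms_iff hK t).1 ht
  obtain ⟨M, I, L, m, d, κ, z, hm, hz, hd, hL, hM⟩ :=
    hA.exists_inflation_comp_deflation hK hc₁ hL₁ hk₂
  obtain ⟨N, k, k', r, hk, hk', -, -⟩ := hK.exists_conflation_comp hk₁ hm
  obtain ⟨P, c, l, r', hc, hl, -, -⟩ := hK.exists_comp_conflation hz hc₂
  exact (hA.weakIsomorphisms_iff hK _).2 ⟨N, I, P, k, _, _, c, hk, hc, by
    simp [reassoc_of% hd], (hA.serre hk').2 ⟨hN₁, hM hN₂⟩, (hA.serre hl).2 ⟨hL, hL₂⟩⟩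

/-! ### Admissibility and weak isomorphisms. -/

lemma admissible_weakIsomorphism_comp {X Y Z : C} {s : X ⟶ Y} {f : Y ⟶ Z}
    (hs : K.weakIsomorphisms A s) (hf : K.Admissible f) : K.Admissible (s ≫ f) := by
  obtain ⟨N₁, I₁, L₁, k₁, p₁, i₁, c₁, hk₁, hc₁, rfl, hN₁, hL₁⟩ :=
    (hA.weakIsomorphisms_iff hK s).1 hs
  obtain ⟨I₂, p₂, i₂, ⟨N₂, k₂, hk₂⟩, hi₂, rfl⟩ := hf
  obtain ⟨M, I, L, m, d, κ, z, hm, hz, hd, hL, hM⟩ :=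
    hA.exists_inflation_comp_deflation hK hc₁ hL₁ hk₂
  exact ⟨I, p₁ ≫ d, κ ≫ i₂, hK.deflation_comp hk₁.deflation hm.deflation,
    hK.inflation_comp hz.inflation hi₂, by simp [reassoc_of% hd]⟩

lemma admissible_comp_weakIsomorphism {X Y Z : C} {f : X ⟶ Y} {s : Y ⟶ Z}
    (hs : K.weakIsomorphisms A s) (hf : K.Admissible f) : K.Admissible (f ≫ s) :=
  op_admissible_iff.1 (hA.op.admissible_weakIsomorphism_comp hK.op (s := s.op) (f := f.op)
    (by rw [hA.op_weakIsomorphisms hK]; exact hs) (op_admissible_iff.2 hf))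

/-- The kernel `N` of `p` embeds in the kernel of the deflation part of `p ≫ f`, by an inflation
since `N` is in `A`. So that deflation part factors as `p` followed by a deflation. -/
lemma admissible_of_deflation_comp {N X X' Y : C} {k : N ⟶ X} {p : X ⟶ X'} {f : X' ⟶ Y}
    (hk : K.Conflation k p) (hN : A N) (hf : K.Admissible (p ≫ f)) : K.Admissible f := by
  obtain ⟨I, q, i, ⟨L, l, hl⟩, hi, hqi⟩ := hf
  have := hK.mono_of_inflation hi
  have := hK.mono hk
  have := hK.epi hk
  have hkq : k ≫ q = 0 := by
    rw [← cancel_mono i, Category.assoc, hqi, reassoc_of% hK.zero hk, zero_comp, zero_comp]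
  obtain ⟨a, ha⟩ := hK.exists_lift hl k hkq
  obtain ⟨L', e, he⟩ := hA.inflation_of_mono hK a (mono_of_mono_fac ha) hN
  obtain ⟨P, m, l', r, hm, hr, hmr, -⟩ := hK.exists_comp_conflation he hl
  rw [ha] at hm
  obtain ⟨u, hu⟩ := hK.exists_iso_of_conflation hk hm
  refine ⟨I, u.hom ≫ r, i, hK.deflation_comp (hK.deflation_isIso _) hr.deflation, hi, ?_⟩
  rw [← cancel_epi p, ← hqi, ← hmr, ← hu]
  simp

/-- The induced map from `L` to the cokernel of `i ≫ f` is admissible, with image `B`. The extension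
`Y'` of `B` by `I` inside `Y` is the image of `f`: the map `P ⟶ Y'` is a base change of `L ⟶ B`,
hence a deflation. -/
lemma admissible_of_inflation_comp_inflation {I P L Y : C} {i : I ⟶ P} {r : P ⟶ L} {f : P ⟶ Y}
    (hi : K.Conflation i r) (hL : A L) (hf : K.Inflation (i ≫ f)) : K.Admissible f := by
  obtain ⟨Z, g, hg⟩ := hf
  obtain ⟨γ, hγ⟩ := hK.exists_desc hi (f ≫ g) (by rw [← Category.assoc, hK.zero hg])
  obtain ⟨_, B, Z', _, β, j, z, hβ, hj, hβj, -, -⟩ := hA.exists_from γ hL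
  obtain ⟨Y', y', x, r', hy', hx, hxy, hyg⟩ := hK.exists_conflation_comp hg hj
  obtain ⟨φ, hφ⟩ := hK.exists_lift hy' f
    (by rw [← reassoc_of% hγ, ← reassoc_of% hβj, hK.zero hj, comp_zero, comp_zero])
  have := hK.mono hy'
  have := hK.mono hj
  have hsq := hK.isPullback_of_conflations hi hx (φ := φ) (β := β)
    (by rw [← cancel_mono y', Category.assoc, hφ, hxy])
    (by rw [← cancel_mono j, Category.assoc, ← hyg, reassoc_of% hφ, Category.assoc, hβj, hγ])
  exact ⟨Y', φ, y', hK.deflation_of_isPullback hsq hβ.deflation,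
    hy'.inflation, hφ⟩

/-- Dividing `X` by the kernel of the deflation part of `s ≫ f` reduces to the case where the
composite is an inflation. -/
lemma admissible_of_inflation_comp {W X L Y : C} {s : W ⟶ X} {c : X ⟶ L} {f : X ⟶ Y}
    (hs : K.Conflation s c) (hL : A L) (hf : K.Admissible (s ≫ f)) : K.Admissible f := by
  obtain ⟨I, q, i, ⟨N, l, hl⟩, hi, hqi⟩ := hf
  obtain ⟨P, m, ι, r, hm, hι, hmr, hsm⟩ := hK.exists_comp_conflation hl hs
  obtain ⟨f₁, hf₁⟩ := hK.exists_desc hm f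
    (by rw [Category.assoc, ← hqi, reassoc_of% hK.zero hl, zero_comp])
  have := hK.epi hl
  have hιf : ι ≫ f₁ = i := by
    rw [← cancel_epi q, ← reassoc_of% hsm, hf₁, hqi]
  obtain ⟨J, p, j, hp, hj, rfl⟩ :=
    hA.admissible_of_inflation_comp_inflation hK hι hL (by rwa [hιf])
  exact ⟨J, m ≫ p, j, hK.deflation_comp hm.deflation hp, hj, by rw [Category.assoc, hf₁]⟩

lemma admissible_of_weakIsomorphism_comp {X Y Z : C} {s : X ⟶ Y} {f : Y ⟶ Z}
    (hs : K.weakIsomorphisms A s) (hf : K.Admissible (s ≫ f)) : K.Admissible f := by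
  obtain ⟨N, I, L, k, p, i, c, hk, hc, rfl, hN, hL⟩ := (hA.weakIsomorphisms_iff hK s).1 hs
  rw [Category.assoc] at hf
  exact hA.admissible_of_inflation_comp hK hc hL (hA.admissible_of_deflation_comp hK hk hN hf)

lemma admissible_of_comp_weakIsomorphism {X Y Z : C} {f : X ⟶ Y} {s : Y ⟶ Z}
    (hs : K.weakIsomorphisms A s) (hf : K.Admissible (f ≫ s)) : K.Admissible f :=
  op_admissible_iff.1 (hA.op.admissible_of_weakIsomorphism_comp hK.op (s := s.op) (f := f.op)
    (by rw [hA.op_weakIsomorphisms hK]; exact hs) (op_admissible_iff.2 hf))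

/-! ### Two-out-of-six. -/

/-- The kernel of the first factor of a weak isomorphism lies in `A`. -/
lemma kernel_of_comp {N X I Y Z : C} {k : N ⟶ X} {p : X ⟶ I} {b : X ⟶ Y} {v : Y ⟶ Z}
    (hk : K.Conflation k p) (hkb : k ≫ b = 0) (h : K.weakIsomorphisms A (b ≫ v)) : A N := by
  obtain ⟨N', I', L', k', p', i', c', hk', hc', hp', hN', hL'⟩ :=
    (hA.weakIsomorphisms_iff hK _).1 h
  have := hK.mono hk
  have := hK.mono hc'
  obtain ⟨l, hl⟩ := hK.exists_lift hk' k
    (by rw [← cancel_mono i', Category.assoc, hp', reassoc_of% hkb, zero_comp, zero_comp])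
  exact (hA.of_mono hK l (mono_of_mono_fac hl) hN').1

lemma cokernel_of_comp {X I Y Z L : C} {i : I ⟶ Y} {c : Y ⟶ L} {b : X ⟶ Y} {u : Z ⟶ X}
    (hc : K.Conflation i c) (hbc : b ≫ c = 0) (h : K.weakIsomorphisms A (u ≫ b)) : A L :=
  hA.op.kernel_of_comp hK.op (k := c.op) (p := i.op) (b := b.op) (v := u.op) hc
    (Quiver.Hom.unop_inj hbc) (by rw [hA.op_weakIsomorphisms hK]; exact h)

/-- The kernel of `b` is the kernel `M` of `N' ⟶ S`, where `N'` is the kernel of `b ≫ v`. It is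
included in `X` by an inflation, and `b` is identified with the quotient `q` by it. -/
lemma deflation_of_weakIsomorphism_comp {U X S Z N : C} {k : N ⟶ U} {u : U ⟶ X} {b : X ⟶ S}
    {v : S ⟶ Z} (hu : K.Conflation k (u ≫ b)) (hv : K.weakIsomorphisms A (b ≫ v)) :
    K.Deflation b := by
  obtain ⟨N', I, _, n, p, i, c, hn, hc, hpi, hN', -⟩ := (hA.weakIsomorphisms_iff hK _).1 hv
  obtain ⟨M, E, _, a, e, j, _, ha, hj, hej, -, -⟩ := hA.exists_from (n ≫ b) hN'
  have := hK.mono hc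
  have := hK.mono hj
  have := hK.epi hu
  obtain ⟨V, q, hq⟩ := hK.inflation_comp ha.inflation hn.inflation
  have := hK.epi hq
  have ker : ∀ {T : C} (t : T ⟶ X), t ≫ b = 0 → t ≫ q = 0 := by
    intro T t ht
    obtain ⟨t', rfl⟩ := hK.exists_lift hn t
      (by rw [← cancel_mono i, Category.assoc, hpi, reassoc_of% ht, zero_comp, zero_comp])
    obtain ⟨t'', rfl⟩ := hK.exists_lift ha t'
      (by rw [← cancel_mono j, Category.assoc, hej, ← Category.assoc, ht, zero_comp])
    have := hK.zero hq
    rw [Category.assoc] at this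
    simp [this]
  obtain ⟨μ, hμ⟩ := hK.exists_desc hq b
    (by rw [Category.assoc, ← hej, reassoc_of% hK.zero ha, zero_comp])
  obtain ⟨w, hw⟩ := hK.exists_desc hu (u ≫ q)
    (by rw [← Category.assoc]; exact ker _ (by rw [Category.assoc, hK.zero hu]))
  -- `b ≫ w = q` is known only after precomposition with `u`. On the cover `t` of `X`, the maps `s ≫
  -- u` and `t` agree after `b`, hence after `q`.
  obtain ⟨P, s, t, k', hP, -, hk'⟩ := hK.exists_baseChange hu b
  have := hK.epi hk'
  have hbw : b ≫ w = q := by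
    have h := ker (s ≫ u - t) (by simp [← hP.w])
    rw [Preadditive.sub_comp, sub_eq_zero, Category.assoc, ← hw] at h
    rw [← cancel_epi t, ← h, ← reassoc_of% hP.w]
    simp
  have : IsIso μ := ⟨w, by rw [← cancel_epi q, reassoc_of% hμ, hbw, Category.comp_id],
    by rw [← cancel_epi (u ≫ b), ← Category.assoc, hw, Category.assoc, hμ, Category.comp_id]⟩
  rw [← hμ]
  exact hK.deflation_comp hq.deflation (hK.deflation_isIso μ)

/-- The two-out-of-six property. -/
lemma weakIsomorphisms_of_comp {U X Y Z : C} {u : U ⟶ X} {b : X ⟶ Y} {v : Y ⟶ Z}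
    (hu : K.weakIsomorphisms A (u ≫ b)) (hv : K.weakIsomorphisms A (b ≫ v)) :
    K.weakIsomorphisms A b := by
  obtain ⟨N₁, S, L₁, k₁, p₁, i₁, c₁, hk₁, hc₁, hpi, hN₁, hL₁⟩ :=
    (hA.weakIsomorphisms_iff hK _).1 hu
  -- Restricting `b` to the part `X'` that lands in the image `S` of `u ≫ b` changes it only by the
  -- weak isomorphism `x`, and makes it a deflation onto `S`.
  obtain ⟨X', B, _, x, β, j, _, hx, hj, hβj, hB, -⟩ := hA.exists_to (b ≫ c₁) hL₁
  have := hK.mono hc₁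
  have := hK.mono hj
  obtain ⟨b', hb'⟩ := hK.exists_lift hc₁ (x ≫ b)
    (by rw [Category.assoc, ← hβj, reassoc_of% hK.zero hx, zero_comp])
  obtain ⟨u', hu'⟩ := hK.exists_lift hx u
    (by rw [← cancel_mono j, Category.assoc, hβj, ← Category.assoc, ← hpi, Category.assoc,
      hK.zero hc₁, comp_zero, zero_comp])
  have hub : u' ≫ b' = p₁ := by
    rw [← cancel_mono i₁, Category.assoc, hb', reassoc_of% hu', hpi]
  have hxW := hA.weakIsomorphisms_inflation hK hx hB
  have hb'd : K.Deflation b' := hA.deflation_of_weakIsomorphism_comp hK (u := u') (v := i₁ ≫ v)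
    (by rwa [hub]) (by
      rw [reassoc_of% hb']
      exact hA.weakIsomorphisms_comp hK hxW hv)
  obtain ⟨I, p, i, ⟨N, k, hk⟩, ⟨L, c, hc⟩, rfl⟩ := hA.admissible_of_weakIsomorphism_comp hK
    (f := b) hxW ⟨S, b', i₁, hb'd, hc₁.inflation, hb'⟩
  exact (hA.weakIsomorphisms_iff hK _).2 ⟨N, I, L, k, p, i, c, hk, hc, rfl,
    hA.kernel_of_comp hK hk (by rw [reassoc_of% hK.zero hk, zero_comp]) hv,
    hA.cokernel_of_comp hK hc (by rw [Category.assoc, hK.zero hc, comp_zero]) hu⟩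

/-! ### Calculus of fractions. -/

/-- Base change of a weak isomorphism along a deflation. -/
lemma exists_isPullback_weakIsomorphism {N X J Z : C} {k : N ⟶ X} {p : X ⟶ Z} {s : J ⟶ Z}
    (hp : K.Conflation k p) (hs : K.weakIsomorphisms A s) :
    ∃ (P : C) (s' : P ⟶ X) (p' : P ⟶ J), K.weakIsomorphisms A s' ∧ K.Deflation p' ∧
      s' ≫ p = p' ≫ s := by
  obtain ⟨M, I, L, m, q, i, c, hm, hc, rfl, hM, hL⟩ := (hA.weakIsomorphisms_iff hK s).1 hs
  obtain ⟨X', x, _, r, hx, hr, -, hxp⟩ := hK.exists_conflation_comp hp hc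
  obtain ⟨P, p', x', m', hP, -, hm'⟩ := hK.exists_baseChange hm r
  exact ⟨P, x' ≫ x, p', hA.weakIsomorphisms_comp hK (hA.weakIsomorphisms_deflation hK hm' hM)
    (hA.weakIsomorphisms_inflation hK hx hL), hK.deflation_of_isPullback hP.flip hr.deflation,
    by rw [Category.assoc, hxp, ← reassoc_of% hP.w]⟩

lemma hasRightCalculusOfFractions : (K.weakIsomorphisms A).HasRightCalculusOfFractions where
  id_mem X := by
    have : HasZeroObject C := hasZeroObject_of_hasFiniteBiproducts C
    exact hA.weakIsomorphisms_deflation hK (hK.isIso_conflation (𝟙 X) (isZero_zero C))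
      (hA.of_isZero hK (isZero_zero C))
  comp_mem f g hf hg := hA.weakIsomorphisms_comp hK hf hg
  exists_rightFraction X Y φ := by
    obtain ⟨M, I, L, m, p, i, c, hm, hc, hpi, hM, hL⟩ := (hA.weakIsomorphisms_iff hK φ.s).1 φ.hs
    obtain ⟨X', B, _, x, β, j, _, hx, hj, hβj, hB, -⟩ := hA.exists_to (φ.f ≫ c) hL
    obtain ⟨l, hl⟩ := hK.exists_lift hc (x ≫ φ.f)
      (by rw [Category.assoc, ← hβj, reassoc_of% hK.zero hx, zero_comp])
    obtain ⟨P, g, x', m', hP, -, hm'⟩ := hK.exists_baseChange hm l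
    exact ⟨⟨x' ≫ x, hA.weakIsomorphisms_comp hK (hA.weakIsomorphisms_deflation hK hm' hM)
      (hA.weakIsomorphisms_inflation hK hx hB), g⟩, by
        dsimp
        rw [Category.assoc, ← hl, ← hpi, ← reassoc_of% hP.w]⟩
  ext X Y Y' f₁ f₂ s hs h := by
    obtain ⟨M, I, L, m, p, i, c, hm, hc, rfl, hM, hL⟩ := (hA.weakIsomorphisms_iff hK s).1 hs
    have := hK.mono hc
    obtain ⟨l, hl⟩ := hK.exists_lift hm (f₁ - f₂) (by
      rw [← cancel_mono i, Category.assoc, Preadditive.sub_comp, h, sub_self, zero_comp])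
    -- The difference factors through `M` in `A`, so it vanishes on the kernel `x` of `l`, whose
    -- cokernel `B` is in `A`.
    obtain ⟨X', B, _, x, β, j, _, hx, hj, hβj, hB, -⟩ := hA.exists_to l hM
    refine ⟨X', x, hA.weakIsomorphisms_inflation hK hx hB, ?_⟩
    rw [← sub_eq_zero, ← Preadditive.comp_sub, ← hl, ← hβj, Category.assoc,
      reassoc_of% hK.zero hx, zero_comp]

lemma hasLeftCalculusOfFractions : (K.weakIsomorphisms A).HasLeftCalculusOfFractions := by
  have h := hA.op.hasRightCalculusOfFractions hK.op
  rw [hA.op_weakIsomorphisms hK] at h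
  exact inferInstanceAs ((K.weakIsomorphisms A).op.unop.HasLeftCalculusOfFractions)

end IsTwoSidedPercolating

end Percolating

/-! ### Passage to the quotient. -/

lemma Conflation.map {C : Type u} [Category.{v} C] {K : SequenceClass C} {D : Type u'}
    [Category.{v'} D] (F : C ⥤ D) {X Y Z : C} {f : X ⟶ Y} {g : Y ⟶ Z} (h : K.Conflation f g) :
    (K.image F).Conflation (F.map f) (F.map g) :=
  ⟨X, Y, Z, f, g, Iso.refl _, Iso.refl _, Iso.refl _, h, by simp, by simp⟩

lemma Admissible.map {C : Type u} [Category.{v} C] {K : SequenceClass C} {D : Type u'}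
    [Category.{v'} D] (F : C ⥤ D) {X Y : C} {f : X ⟶ Y} (h : K.Admissible f) :
    (K.image F).Admissible (F.map f) := by
  obtain ⟨I, p, i, ⟨N, k, hk⟩, ⟨L, c, hc⟩, rfl⟩ := h
  exact ⟨F.obj I, F.map p, F.map i, (hk.map F).deflation, (hc.map F).inflation, by simp⟩

section Localization

variable {E : Type u} [Category.{v} E] [Preadditive E] [HasFiniteBiproducts E]
  {K : SequenceClass E} {A : ObjectProperty E} {D : Type u'} [Category.{v'} D]
  (Q : E ⥤ D) [Q.IsLocalization (K.weakIsomorphisms A)]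

namespace IsTwoSidedPercolating

variable (hA : K.IsTwoSidedPercolating A) (hK : K.IsExactStructure)
include hA hK

/-- The class of weak isomorphisms is saturated. -/
lemma weakIsomorphisms_of_isIso_map {X Y : E} (b : X ⟶ Y) [IsIso (Q.map b)] :
    K.weakIsomorphisms A b := by
  have := hA.hasRightCalculusOfFractions hK
  have := hA.hasLeftCalculusOfFractions hK
  have hQ := Localization.inverts Q (K.weakIsomorphisms A)
  -- Writing the inverse as a left and as a right fraction yields weak isomorphisms that begin and
  -- end with `b`, as two-out-of-six requires.
  obtain ⟨φ, hφ⟩ := Localization.exists_leftFraction Q (K.weakIsomorphisms A) (inv (Q.map b))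
  obtain ⟨ψ, hψ⟩ := Localization.exists_rightFraction Q (K.weakIsomorphisms A) (inv (Q.map b))
  have h₁ : Q.map (b ≫ φ.f) = Q.map φ.s := by
    rw [Q.map_comp, ← φ.map_comp_map_s Q hQ, ← hφ, IsIso.hom_inv_id_assoc]
  have h₂ : Q.map (ψ.f ≫ b) = Q.map ψ.s := by
    rw [Q.map_comp, ← ψ.map_s_comp_map Q hQ, ← hψ, Category.assoc, IsIso.inv_hom_id,
      Category.comp_id]
  obtain ⟨Z, s, hs, hs'⟩ :=
    (MorphismProperty.map_eq_iff_postcomp Q (K.weakIsomorphisms A) _ _).1 h₁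
  obtain ⟨Z', t, ht, ht'⟩ :=
    (MorphismProperty.map_eq_iff_precomp Q (K.weakIsomorphisms A) _ _).1 h₂
  refine hA.weakIsomorphisms_of_comp hK (u := t ≫ ψ.f) (v := φ.f ≫ s) ?_ ?_
  · rw [Category.assoc, ht']
    exact hA.weakIsomorphisms_comp hK ht ψ.hs
  · rw [← Category.assoc, hs']
    exact hA.weakIsomorphisms_comp hK φ.hs hs

/-- Isomorphisms in the quotient are roofs of weak isomorphisms. -/
lemma exists_rightRoof {X Y : E} (α : Q.obj X ≅ Q.obj Y) :
    ∃ (W : E) (a : W ⟶ X) (b : W ⟶ Y), K.weakIsomorphisms A a ∧ K.weakIsomorphisms A b ∧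
      Q.map a ≫ α.hom = Q.map b := by
  have := hA.hasRightCalculusOfFractions hK
  have hQ := Localization.inverts Q (K.weakIsomorphisms A)
  obtain ⟨φ, hφ⟩ := Localization.exists_rightFraction Q (K.weakIsomorphisms A) α.hom
  have h : Q.map φ.s ≫ α.hom = Q.map φ.f := by rw [hφ, φ.map_s_comp_map Q hQ]
  have := hQ _ φ.hs
  have : IsIso (Q.map φ.f) := by rw [← h]; infer_instance
  exact ⟨_, φ.s, φ.f, φ.hs, hA.weakIsomorphisms_of_isIso_map Q hK _, h⟩

lemma exists_leftRoof {X Y : E} (α : Q.obj X ≅ Q.obj Y) :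
    ∃ (W : E) (a : X ⟶ W) (b : Y ⟶ W), K.weakIsomorphisms A a ∧ K.weakIsomorphisms A b ∧
      α.hom ≫ Q.map b = Q.map a := by
  have := hA.hasLeftCalculusOfFractions hK
  have hQ := Localization.inverts Q (K.weakIsomorphisms A)
  obtain ⟨φ, hφ⟩ := Localization.exists_leftFraction Q (K.weakIsomorphisms A) α.hom
  have h : α.hom ≫ Q.map φ.s = Q.map φ.f := by rw [hφ, φ.map_comp_map_s Q hQ]
  have := hQ _ φ.hs
  have : IsIso (Q.map φ.f) := by rw [← h]; infer_instance
  exact ⟨_, φ.f, φ.s, hA.weakIsomorphisms_of_isIso_map Q hK _, φ.hs, h⟩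

/-- A right roof for `α` and a left roof for `β` turn `h` into an equality in `E` after a further
weak isomorphism `e`; the outer factors are then cancelled around `f`. -/
lemma admissible_of_iso {X Y X' Y' : E} {f : X ⟶ Y} {g : X' ⟶ Y'} (hg : K.Admissible g)
    (α : Q.obj X ≅ Q.obj X') (β : Q.obj Y' ≅ Q.obj Y)
    (h : Q.map f = α.hom ≫ Q.map g ≫ β.hom) : K.Admissible f := by
  have := hA.hasRightCalculusOfFractions hK
  obtain ⟨W, a, b, ha, hb, hab⟩ := hA.exists_rightRoof Q hK α
  obtain ⟨V, d, c, hd, hc, hdc⟩ := hA.exists_leftRoof Q hK β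
  have hQ : Q.map (a ≫ f ≫ c) = Q.map (b ≫ g ≫ d) := by
    simp only [Q.map_comp, h, Category.assoc, hdc, reassoc_of% hab]
  obtain ⟨Z, e, he, hfg⟩ := (MorphismProperty.map_eq_iff_precomp Q (K.weakIsomorphisms A) _ _).1 hQ
  refine hA.admissible_of_comp_weakIsomorphism hK hc
    (hA.admissible_of_weakIsomorphism_comp hK ha
      (hA.admissible_of_weakIsomorphism_comp hK he ?_))
  rw [hfg]
  exact hA.admissible_weakIsomorphism_comp hK he (hA.admissible_weakIsomorphism_comp hK hb
    (hA.admissible_comp_weakIsomorphism hK hd hg))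

lemma admissible_of_admissible_map {X Y : E} {f : X ⟶ Y} (hf : (K.image Q).Admissible (Q.map f)) :
    K.Admissible f := by
  obtain ⟨I, p', i', ⟨_, _, N, X₁, I₁, k, p, _, b₁, c₁, hp, -, hp'⟩,
    ⟨_, _, I₂, Y₁, L, i, c, a₂, b₂, _, hi, hi', -⟩, hf⟩ := hf
  -- The target `I₁` of `p` and the source `I₂` of `i` agree only in the quotient, where both are
  -- isomorphic to `I`; `q ≫ t ≫ i` bridges them in `E`.
  obtain ⟨J, s, t, hs, ht, hst⟩ := hA.exists_rightRoof Q hK (c₁ ≪≫ a₂.symm)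
  obtain ⟨P, s', q, hs', hq, hsq⟩ := hA.exists_isPullback_weakIsomorphism hK hp hs
  have := Localization.inverts Q (K.weakIsomorphisms A) _ hs'
  have hg : K.Admissible (q ≫ t ≫ i) := by
    obtain ⟨I', d, j, hd, hj, hdj⟩ := hA.admissible_weakIsomorphism_comp hK ht
      (f := i) ⟨_, 𝟙 _, i, hK.deflation_isIso _, hi.inflation, by simp⟩
    exact ⟨I', q ≫ d, j, hK.deflation_comp hq hd, hj, by rw [Category.assoc, hdj]⟩
  refine hA.admissible_of_iso Q hK hg (b₁.symm ≪≫ (asIso (Q.map s')).symm) b₂ ?_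
  have hp'' : p' = b₁.inv ≫ Q.map p ≫ c₁.hom := by simp [hp']
  have hi'' : i' = a₂.inv ≫ Q.map i ≫ b₂.hom := by simp [hi']
  have hsq' : Q.map p = inv (Q.map s') ≫ Q.map q ≫ Q.map s := by
    rw [← Q.map_comp, ← hsq, Q.map_comp, IsIso.inv_hom_id_assoc]
  simp only [Iso.trans_hom, Iso.symm_hom] at hst
  simp only [← hf, hp'', hi'', hsq', Q.map_comp, ← hst, Iso.trans_hom, Iso.symm_hom, asIso_inv,
    Category.assoc]

end IsTwoSidedPercolating

end Localization

end SequenceClass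

end PercolatingQuotient

/-- `K` is an exact structure on the additive category `E`, `A` is a two-sided admissibly
percolating subcategory, and `Q : E ⥤ D` is a localization of `E` at the weak
`A`-isomorphisms, i.e. the quotient functor onto `D = E / A`; the conflations of the quotient
are the sequences isomorphic to the images of conflations of `E`. -/
theorem mainTheorem7 {E : Type u} [Category.{v} E] [Preadditive E]
    [HasFiniteBiproducts E]
    (K : PercolatingQuotient.SequenceClass E) (hK : K.IsExactStructure)
    (A : ObjectProperty E) (hA : K.IsTwoSidedPercolating A)
    {D : Type u'} [Category.{v'} D] (Q : E ⥤ D) [Q.IsLocalization (K.weakIsomorphisms A)]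
    {X Y : E} (f : X ⟶ Y) :
    K.Admissible f ↔ (K.image Q).Admissible (Q.map f) :=
  ⟨fun h => h.map Q, hA.admissible_of_admissible_map Q hK⟩
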